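/- Let $H$ be a separable complex Hilbert space. Given an orthonormal basis $(e_n)_{n\in\mathbb N}$ of $H$ and infinite sets $P=\{p_1<p_2<\cdots\}$ and $Q=\{q_1<q_2<\cdots\}$ of natural numbers, the spread $S_{P,Q}$ (with respect to this basis) is the bounded operator with $S_{P,Q}e_{p_k}=e_{q_k}$ for all $k$ and $S_{P,Q}e_n=0$ for $n\notin P$. A unitary operator $U$ on $H$ is called a unitary spread if there are an orthonormal basis $(e_n)_{n\in\mathbb N}$ of $H$ and a sequence of spreads $S_{P_n,Q_n}$ with respect to it such that $\sum_{n=1}^\infty S_{P_n,Q_n}$ converges to $U$ in the strong operator topology. A ring is a set of the form $\{\lambda\in\mathbb C: a<|\lambda|<b\}$ with $0<a<b<\infty$, where each of the two inequalities $a<|\lambda|$, $|\lambda|<b$ may be replaced by the non-strict one. Write $\sigma(T)$ and $\sigma_p(T)$ for the spectrum and the set of eigenvalues of a bounded operator $T$. Theorem. Let $0<\lambda_1<\lambda_2$ and let $A$ be a bounded self-adjoint operator on $H$ with $\sigma(A)=[\lambda_1,\lambda_2]$ and $\sigma_p(A)=\varnothing$. Then for every ring $R\subseteq\{\lambda\in\mathbb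 C:\lambda_1<|\lambda|<\lambda_2\}$ there exists a unitary spread $U$ on $H$ such that $\sigma_p(UA)=R$. -/

import Mathlib

open Filter Topology

section UnitarySpread

variable {H : Type*} [NormedAddCommGroup H] [InnerProductSpace ℂ H]

/-- The point spectrum `σ_p(T)`: the set of eigenvalues of the bounded operator `T`. -/
def pointSpectrum (T : H →L[ℂ] H) : Set ℂ :=
  {μ | Module.End.HasEigenvalue (T : H →ₗ[ℂ] H) μ}

/-- The increasing enumeration `a₀ < a₁ < ⋯` of an infinite set `A ⊆ ℕ` picks out an orthonormal
subsequence `e_{a₀}, e_{a₁}, …` of an orthonormal basis `e`. -/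
theorem orthonormal_subsequence (e : HilbertBasis ℕ ℂ H) {A : Set ℕ} (hA : A.Infinite) :
    Orthonormal ℂ (fun k : ℕ => e (Nat.nth (· ∈ A) k)) :=
  e.orthonormal.comp _ (Nat.nth_injective hA)

variable [CompleteSpace H]

/-- The isometry `ℓ² → H` sending the `k`-th unit vector to `e_{a_k}`, where `a₀ < a₁ < ⋯` is the
increasing enumeration of the infinite set `A`. -/
noncomputable def subsequenceIsometry (e : HilbertBasis ℕ ℂ H) {A : Set ℕ} (hA : A.Infinite) :
    lp (fun _ : ℕ => ℂ) 2 →ₗᵢ[ℂ] H :=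
  (orthonormal_subsequence e hA).orthogonalFamily.linearIsometry

/-- The spread `S_{A,B}` from `A` to `B` (infinite subsets of `ℕ` with increasing enumerations
`a₀ < a₁ < ⋯` and `b₀ < b₁ < ⋯`) with respect to the orthonormal basis `e`: the bounded operator
with `S e_{a_k} = e_{b_k}` for all `k` and `S e_n = 0` for `n ∉ A`; see `spread_apply_nth` and
`spread_apply_of_notMem`. -/
noncomputable def spread (e : HilbertBasis ℕ ℂ H) {A B : Set ℕ} (hA : A.Infinite)
    (hB : B.Infinite) : H →L[ℂ] H :=
  (subsequenceIsometry e hB).toContinuousLinearMap ∘L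
    ContinuousLinearMap.adjoint (subsequenceIsometry e hA).toContinuousLinearMap

theorem subsequenceIsometry_single (e : HilbertBasis ℕ ℂ H) {A : Set ℕ} (hA : A.Infinite) (k : ℕ) :
    subsequenceIsometry e hA (lp.single 2 k (1 : ℂ)) = e (Nat.nth (· ∈ A) k) := by
  simp [subsequenceIsometry, OrthogonalFamily.linearIsometry_apply_single]

theorem adjoint_subsequenceIsometry_apply (e : HilbertBasis ℕ ℂ H) {A : Set ℕ} (hA : A.Infinite)
    (y : H) (k : ℕ) :
    ContinuousLinearMap.adjoint (subsequenceIsometry e hA).toContinuousLinearMap y k =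
      inner ℂ (e (Nat.nth (· ∈ A) k)) y := by
  have h := lp.inner_single_left (𝕜 := ℂ) k (1 : ℂ)
    (ContinuousLinearMap.adjoint (subsequenceIsometry e hA).toContinuousLinearMap y)
  rw [ContinuousLinearMap.adjoint_inner_right] at h
  simpa [subsequenceIsometry_single] using h.symm

theorem spread_apply_nth (e : HilbertBasis ℕ ℂ H) {A B : Set ℕ} (hA : A.Infinite)
    (hB : B.Infinite) (k : ℕ) :
    spread e hA hB (e (Nat.nth (· ∈ A) k)) = e (Nat.nth (· ∈ B) k) := by
  have h : ContinuousLinearMap.adjoint (subsequenceIsometry e hA).toContinuousLinearMap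
      (e (Nat.nth (· ∈ A) k)) = lp.single 2 k (1 : ℂ) := by
    ext j
    rw [adjoint_subsequenceIsometry_apply,
      orthonormal_iff_ite.mp (orthonormal_subsequence e hA) j k]
    simp [lp.single_apply, Pi.single_apply]
  simp [spread, h, subsequenceIsometry_single]

theorem spread_apply_of_notMem (e : HilbertBasis ℕ ℂ H) {A B : Set ℕ} (hA : A.Infinite)
    (hB : B.Infinite) {n : ℕ} (hn : n ∉ A) : spread e hA hB (e n) = 0 := by
  have h : ContinuousLinearMap.adjoint (subsequenceIsometry e hA).toContinuousLinearMap
      (e n) = 0 := by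
    ext j
    rw [adjoint_subsequenceIsometry_apply, orthonormal_iff_ite.mp e.orthonormal,
      if_neg fun hj : Nat.nth (· ∈ A) j = n => hn (hj ▸ Nat.nth_mem_of_infinite hA j)]
    rfl
  simp [spread, h]

/-- A unitary operator `U` is a unitary spread if, for some orthonormal basis `(e_n)` of `H`, it is
the limit in the strong operator topology of a series of spreads `∑ S_{A_n,B_n}` (with respect to
that basis). -/
def IsUnitarySpread (U : H →L[ℂ] H) : Prop :=
  U ∈ unitary (H →L[ℂ] H) ∧
    ∃ (e : HilbertBasis ℕ ℂ H) (A B : ℕ → Set ℕ) (hA : ∀ n, (A n).Infinite)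
      (hB : ∀ n, (B n).Infinite),
      ∀ x : H, Tendsto (fun N : ℕ => ∑ n ∈ Finset.range N, spread e (hA n) (hB n) x)
        atTop (𝓝 (U x))

end UnitarySpread

/-- A ring: an annulus centred at the origin with radii `0 < a < b`, where each of the two boundary
circles may or may not be included. -/
def IsAnnularRing (R : Set ℂ) : Prop :=
  ∃ a b : ℝ, 0 < a ∧ a < b ∧
    (R = {z : ℂ | a < ‖z‖ ∧ ‖z‖ < b} ∨ R = {z : ℂ | a ≤ ‖z‖ ∧ ‖z‖ ≤ b} ∨
      R = {z : ℂ | a ≤ ‖z‖ ∧ ‖z‖ < b} ∨ R = {z : ℂ | a < ‖z‖ ∧ ‖z‖ ≤ b})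

/-! ### Spectral subspaces of intervals via the continuous functional calculus -/

section SpectralSubspace

variable {H : Type*} [NormedAddCommGroup H] [InnerProductSpace ℂ H]

/-! The operator `UA` is made into a block-weighted bilateral shift. Choose disjoint intervals `[p
n, q n]`, `n ∈ ℤ`, in the spectrum of `A`. Let `K n` be their spectral subspaces for `n ≠ 0`, and `K
0` the orthogonal complement of all of these. Each `K n` is nonzero and `A`-invariant, hence
infinite-dimensional because `A` has no eigenvalues. So orthonormal bases of the `K n` form an array
with infinite rows, and the unitary `U` shifting row `n` to row `n + 1` is a strong sum of spreads,
one per row (`exists_isUnitarySpread_map_eq`).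

If `UAx = μx`, the components satisfy `μ x_{n+1} = UA x_n`, so for `n ≠ 0` each step scales norms by
a factor between `p n / |μ|` and `q n / |μ|`. An eigenvector exists exactly when a two-sided orbit
is square-summable. For a ring with radii `a < b` the intervals accumulate at `a` as `n → ∞` and at
`b` as `n → -∞`. Approaching `a` from above gives decay exactly for `|μ| > a`. Approaching it from
below at rate `1/n` also gives decay for `|μ| = a`, since the products are then `O(1/n)`. The end at
`b` is the same problem after inverting all radii. -/

theorem not_finiteDimensional_of_invariant {A : H →L[ℂ] H} (hpoint : pointSpectrum A = ∅)
    {K : Submodule ℂ H} (hK : K ≠ ⊥) (hinv : ∀ x ∈ K, A x ∈ K) : ¬ FiniteDimensional ℂ K := by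
  intro hfin
  have : Nontrivial K := Submodule.nontrivial_iff_ne_bot.2 hK
  obtain ⟨μ, hμ⟩ := Module.End.exists_eigenvalue ((A : H →ₗ[ℂ] H).restrict hinv)
  obtain ⟨v, hv⟩ := hμ.exists_hasEigenvector
  have : μ ∈ pointSpectrum A := by
    refine Module.End.hasEigenvalue_of_hasEigenvector (x := (v : H))
      ⟨Module.End.mem_eigenspace_iff.2 ?_, fun h => hv.2 (Subtype.ext h)⟩
    exact congrArg Subtype.val hv.apply_eq_smul
  rw [hpoint] at this
  exact this

variable [CompleteSpace H]

/-- The spectral subspace of a self-adjoint operator for the interval `[c, d]`: the vectors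
annihilated by `f(A)` for every continuous `f` vanishing on `[c, d]`. -/
noncomputable def intervalSubspace (A : H →L[ℂ] H) (c d : ℝ) : Submodule ℂ H :=
  ⨅ (f : ℝ → ℝ) (_ : Continuous f) (_ : ∀ t ∈ Set.Icc c d, f t = 0), (cfc f A).ker

theorem mem_intervalSubspace {A : H →L[ℂ] H} {c d : ℝ} {x : H} :
    x ∈ intervalSubspace A c d ↔
      ∀ f : ℝ → ℝ, Continuous f → (∀ t ∈ Set.Icc c d, f t = 0) → cfc f A x = 0 := by
  simp [intervalSubspace, Submodule.mem_iInf]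

theorem isClosed_intervalSubspace (A : H →L[ℂ] H) (c d : ℝ) :
    IsClosed (intervalSubspace A c d : Set H) := by
  simp only [intervalSubspace, Submodule.coe_iInf]
  exact isClosed_iInter fun f => isClosed_iInter fun _ => isClosed_iInter fun _ =>
    (cfc f A).isClosed_ker

variable {A : H →L[ℂ] H}

theorem cfc_apply_eq_of_mem {c d : ℝ} {x : H}
    (hx : x ∈ intervalSubspace A c d) {f g : ℝ → ℝ} (hf : Continuous f) (hg : Continuous g)
    (hfg : ∀ t ∈ Set.Icc c d, f t = g t) : cfc f A x = cfc g A x := by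
  have h := mem_intervalSubspace.1 hx (fun t => f t - g t) (hf.sub hg)
    fun t ht => sub_eq_zero.2 (hfg t ht)
  rw [cfc_sub f g A hf.continuousOn hg.continuousOn] at h
  exact sub_eq_zero.1 h

theorem apply_mem_intervalSubspace (hA : IsSelfAdjoint A) {c d : ℝ} {x : H}
    (hx : x ∈ intervalSubspace A c d) : A x ∈ intervalSubspace A c d := by
  refine mem_intervalSubspace.2 fun f hf hfz => ?_
  have h : Commute (cfc f A) A := by
    conv_rhs => rw [← cfc_id ℝ A]
    exact cfc_commute_cfc f id A
  have h' := congrArg (fun B : H →L[ℂ] H => B x) h.eq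
  simp only [mul_apply_eq_comp] at h'
  rw [h', mem_intervalSubspace.1 hx f hf hfz, map_zero]

/-- A continuous ramp that is `0` up to `d` and `1` from `c'` on gives a self-adjoint operator
killing `x` and fixing `y`. -/
theorem inner_eq_zero_of_mem_intervalSubspace (hA : IsSelfAdjoint A) {c d c' d' : ℝ}
    (h : d < c') {x y : H} (hx : x ∈ intervalSubspace A c d)
    (hy : y ∈ intervalSubspace A c' d') : inner ℂ x y = 0 := by
  have hcont : Continuous fun t : ℝ => max 0 (min 1 ((t - d) / (c' - d))) := by fun_prop
  have hpos : 0 < c' - d := sub_pos.2 h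
  have h1 := mem_intervalSubspace.1 hx _ hcont fun t ht => by
    have : (t - d) / (c' - d) ≤ 0 := div_nonpos_of_nonpos_of_nonneg (by linarith [ht.2]) hpos.le
    exact max_eq_left ((min_le_right _ _).trans this)
  have h2 := cfc_apply_eq_of_mem hy hcont (continuous_const (y := (1 : ℝ))) fun t ht => by
    have : 1 ≤ (t - d) / (c' - d) := (one_le_div hpos).2 (by linarith [ht.1])
    rw [min_eq_left this, max_eq_right zero_le_one]
  rw [cfc_const_one ℝ A] at h2
  have h3 : IsSelfAdjoint (cfc (fun t : ℝ => max 0 (min 1 ((t - d) / (c' - d)))) A) :=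
    cfc_predicate _ A
  have h4 : y = cfc (fun t : ℝ => max 0 (min 1 ((t - d) / (c' - d)))) A y := by
    rw [h2]; rfl
  rw [h4, ← ContinuousLinearMap.adjoint_inner_left, ← ContinuousLinearMap.star_eq_adjoint,
    h3.star_eq, h1, inner_zero_left]

theorem continuous_clamp (c d : ℝ) : Continuous fun t : ℝ => max c (min d t) := by fun_prop

theorem clamp_eq {c d t : ℝ} (ht : t ∈ Set.Icc c d) : max c (min d t) = t := by
  rw [min_eq_right ht.2, max_eq_right ht.1]

/-- On this subspace `A` acts as its clamp to `[c, d]`, a function bounded by `d`. The lower bound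
below uses the reciprocal of the clamp, bounded by `c⁻¹`, as a left inverse of `A` there. -/
theorem norm_apply_le_of_mem_intervalSubspace (hA : IsSelfAdjoint A) {c d : ℝ} (hc : 0 < c)
    (hcd : c ≤ d) {x : H} (hx : x ∈ intervalSubspace A c d) : ‖A x‖ ≤ d * ‖x‖ := by
  have h := cfc_apply_eq_of_mem hx (continuous_clamp c d) continuous_id fun t ht => clamp_eq ht
  rw [cfc_id ℝ A] at h
  rw [← h]
  refine ContinuousLinearMap.le_of_opNorm_le _ (norm_cfc_le (hc.le.trans hcd) fun t _ => ?_) x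
  rw [Real.norm_of_nonneg (hc.le.trans (le_max_left _ _))]
  exact max_le hcd (min_le_left _ _)

theorem le_norm_apply_of_mem_intervalSubspace (hA : IsSelfAdjoint A) {c d : ℝ} (hc : 0 < c)
    {x : H} (hx : x ∈ intervalSubspace A c d) : c * ‖x‖ ≤ ‖A x‖ := by
  have hpos : ∀ t : ℝ, 0 < max c (min d t) := fun t => hc.trans_le (le_max_left _ _)
  have hinv : Continuous fun t : ℝ => (max c (min d t))⁻¹ :=
    (continuous_clamp c d).inv₀ fun t => (hpos t).ne'
  have h := cfc_apply_eq_of_mem hx (f := fun t => (max c (min d t))⁻¹ * id t)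
    (hinv.mul continuous_id) (continuous_const (y := (1 : ℝ))) fun t ht => by
      rw [clamp_eq ht]
      exact inv_mul_cancel₀ (hc.trans_le ht.1).ne'
  rw [cfc_const_one ℝ A, cfc_mul _ _ A hinv.continuousOn continuous_id.continuousOn,
    cfc_id ℝ A] at h
  have h' : ‖x‖ ≤ c⁻¹ * ‖A x‖ := by
    calc ‖x‖ = ‖cfc (fun t : ℝ => (max c (min d t))⁻¹) A (A x)‖ := congrArg norm h.symm
      _ ≤ c⁻¹ * ‖A x‖ := by
        refine ContinuousLinearMap.le_of_opNorm_le _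
          (norm_cfc_le (inv_nonneg.2 hc.le) fun t _ => ?_) _
        rw [Real.norm_of_nonneg (inv_nonneg.2 (hpos t).le)]
        exact inv_anti₀ hc (le_max_left _ _)
  calc c * ‖x‖ ≤ c * (c⁻¹ * ‖A x‖) := by gcongr
    _ = ‖A x‖ := mul_inv_cancel_left₀ hc.ne' _

/-- For a tent function supported on `[c, d]`, the range of its functional calculus lies in the
subspace. Were that trivial, the tent would vanish on the spectrum, which contains the midpoint. -/
theorem intervalSubspace_ne_bot (hA : IsSelfAdjoint A) {c d : ℝ} (hcd : c < d)
    (hspec : Set.Icc c d ⊆ spectrum ℝ A) : intervalSubspace A c d ≠ ⊥ := by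
  have hcont : Continuous fun t : ℝ => max 0 (min (t - c) (d - t)) := by fun_prop
  intro hbot
  have hz : cfc (fun t : ℝ => max 0 (min (t - c) (d - t))) A = 0 := by
    ext y
    have hmem : cfc (fun t : ℝ => max 0 (min (t - c) (d - t))) A y ∈ intervalSubspace A c d := by
      refine mem_intervalSubspace.2 fun f hf hfz => ?_
      rw [← mul_apply_eq_comp, ← cfc_mul f _ A hf.continuousOn hcont.continuousOn]
      have : (fun t => f t * max 0 (min (t - c) (d - t))) = fun _ => 0 := by
        ext t
        by_cases ht : t ∈ Set.Icc c d
        · rw [hfz t ht, zero_mul]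
        · rw [max_eq_left, mul_zero]
          rcases not_and_or.1 ht with h | h
          · exact (min_le_left _ _).trans (by linarith)
          · exact (min_le_right _ _).trans (by linarith)
      rw [this, cfc_const_zero]
      rfl
    rwa [hbot, Submodule.mem_bot] at hmem
  rw [← cfc_const_zero ℝ A, cfc_eq_cfc_iff_eqOn hA hcont.continuousOn
    continuousOn_const] at hz
  have := hz (hspec (⟨by linarith, by linarith⟩ : (c + d) / 2 ∈ Set.Icc c d))
  have hpos : 0 < max 0 (min ((c + d) / 2 - c) (d - (c + d) / 2)) :=
    lt_max_of_lt_right (lt_min (by linarith) (by linarith))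
  exact hpos.ne' this

end SpectralSubspace

/-! ### Row shifts of an orthonormal array as unitary spreads -/

section ShiftSpread

variable {H : Type*} [NormedAddCommGroup H] [InnerProductSpace ℂ H]

/-- Orthonormal vectors are `√2` apart, so balls of radius `1/2` around them are disjoint. -/
theorem Orthonormal.countable_of_separableSpace [TopologicalSpace.SeparableSpace H] {ι : Type*}
    {v : ι → H} (hv : Orthonormal ℂ v) : Countable ι := by
  have hdisj : Pairwise (Function.onFun Disjoint fun i => Metric.ball (v i) (1 / 2)) := by
    intro i j hij
    refine Metric.ball_disjoint_ball ?_
    have h : ‖v i - v j‖ ^ 2 = 2 := by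
      rw [@norm_sub_sq ℂ, hv.2 hij, hv.1 i, hv.1 j]
      norm_num
    rw [dist_eq_norm]
    nlinarith [norm_nonneg (v i - v j)]
  exact hdisj.countable_of_isOpen_disjoint (fun _ => Metric.isOpen_ball)
    fun i => ⟨v i, Metric.mem_ball_self (by norm_num)⟩

theorem exists_hilbertBasis_nat [CompleteSpace H] [TopologicalSpace.SeparableSpace H]
    (hH : ¬ FiniteDimensional ℂ H) :
    ∃ v : ℕ → H, Orthonormal ℂ v ∧ (Submodule.span ℂ (Set.range v))ᗮ = ⊥ := by
  obtain ⟨w, b, -⟩ := exists_hilbertBasis ℂ H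
  have : Countable w := b.orthonormal.countable_of_separableSpace
  have : Infinite w := by
    by_contra hfin
    rw [not_infinite_iff_finite] at hfin
    have := Fintype.ofFinite w
    exact hH b.toOrthonormalBasis.toBasis.finiteDimensional_of_finite
  obtain ⟨eqv⟩ := nonempty_equiv_of_countable (α := ℕ) (β := w)
  refine ⟨b ∘ eqv, b.orthonormal.comp _ eqv.injective, ?_⟩
  rw [eqv.surjective.range_comp, ← Submodule.topologicalClosure_eq_top_iff]
  exact b.dense_span

variable [CompleteSpace H]

theorem infinite_range_pair (k : ℕ) : (Set.range (Nat.pair k)).Infinite :=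
  Set.infinite_range_of_injective fun _ _ h => (Nat.pair_eq_pair.1 h).2

/-- `Nat.pair k` is increasing, so it is the enumeration of its own row. Hence a spread between two
rows preserves the column index. -/
theorem nth_range_pair (k m : ℕ) : Nat.nth (· ∈ Set.range (Nat.pair k)) m = Nat.pair k m := by
  have h1 : StrictMono (Nat.nth (· ∈ Set.range (Nat.pair k))) :=
    Nat.nth_strictMono (infinite_range_pair k)
  have h2 : StrictMono (Nat.pair k) := fun _ _ h => Nat.pair_lt_pair_right k h
  have h3 : Set.range (Nat.nth (· ∈ Set.range (Nat.pair k))) = Set.range (Nat.pair k) :=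
    Nat.range_nth_of_infinite (infinite_range_pair k)
  exact congrFun ((h1.range_inj h2).1 h3) m

/-- A unitary permuting the rows of an orthonormal basis arranged as an infinite array is the
strong sum of the spreads carrying one row to another. -/
theorem isUnitarySpread_of_rows (e : HilbertBasis ℕ ℂ H) (s : ℕ → ℕ) {U : H →L[ℂ] H}
    (hU : U ∈ unitary (H →L[ℂ] H))
    (hUe : ∀ k m, U (e (Nat.pair k m)) = e (Nat.pair (s k) m)) : IsUnitarySpread U := by
  refine ⟨hU, e, fun k => Set.range (Nat.pair k), fun k => Set.range (Nat.pair (s k)),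
    fun k => infinite_range_pair k, fun k => infinite_range_pair (s k), fun x => ?_⟩
  have hx : HasSum (fun p : ℕ × ℕ => inner ℂ (e (Nat.pair p.1 p.2)) x • e (Nat.pair p.1 p.2)) x := by
    have h := e.hasSum_repr x
    simp only [e.repr_apply_apply] at h
    rw [← Nat.pairEquiv.hasSum_iff] at h
    simpa only [Function.comp_def, Nat.pairEquiv_apply, Function.uncurry_def] using h
  have hUx := U.hasSum hx
  simp only [map_smul, hUe] at hUx
  -- Group the expansion of `U x` by rows: the sum over row `k` is the `k`-th spread applied to `x`.
  refine (hUx.prod_fiberwise fun k => ?_).tendsto_sum_nat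
  have hS := (spread e (infinite_range_pair k) (infinite_range_pair (s k))).hasSum hx
  have hinj : Function.Injective fun m : ℕ => (k, m) := fun _ _ h => (Prod.mk.inj h).2
  rw [← hinj.hasSum_iff] at hS
  · convert hS using 2 with m
    have := spread_apply_nth e (infinite_range_pair k) (infinite_range_pair (s k)) m
    rw [nth_range_pair, nth_range_pair] at this
    simp [this]
  · rintro ⟨j, m⟩ hjm
    rw [map_smul, spread_apply_of_notMem, smul_zero]
    rintro ⟨m', hm'⟩
    obtain ⟨rfl, rfl⟩ := Nat.pair_eq_pair.1 hm'
    exact hjm ⟨_, rfl⟩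

/-- A Hilbert space which is the orthogonal sum of infinite-dimensional closed subspaces `K n`,
`n ∈ ℤ`, carries a unitary spread mapping each `K n` onto `K (n + 1)`. -/
theorem exists_isUnitarySpread_map_eq
    [TopologicalSpace.SeparableSpace H] (K : ℤ → Submodule ℂ H) [∀ n, CompleteSpace (K n)]
    (hinf : ∀ n, ¬ FiniteDimensional ℂ (K n)) (horth : ∀ i j, i ≠ j → K i ⟂ K j)
    (htop : (⨆ n, K n)ᗮ = ⊥) :
    ∃ U : H ≃ₗᵢ[ℂ] H, IsUnitarySpread (U : H →L[ℂ] H) ∧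
      ∀ n, (∀ x ∈ K n, U x ∈ K (n + 1)) ∧ ∀ x ∈ (K n)ᗮ, U x ∈ (K (n + 1))ᗮ := by
  choose v hv hvbot using fun n => exists_hilbertBasis_nat (hinf n)
  let g : ℤ × ℕ → H := fun p => v p.1 p.2
  have hmem : ∀ p, g p ∈ K p.1 := fun p => (v p.1 p.2).2
  have hg : Orthonormal ℂ g := by
    refine ⟨fun p => (hv p.1).1 p.2, ?_⟩
    rintro ⟨i, m⟩ ⟨j, m'⟩ hne
    by_cases hij : i = j
    · subst hij
      exact (hv i).2 fun h => hne (congrArg (Prod.mk i) h)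
    · exact (horth i j hij).inner_eq (hmem (i, m)) (hmem (j, m'))
  have hperp : ∀ n x, (∀ m, inner ℂ (g (n, m)) x = 0) → x ∈ (K n)ᗮ := by
    intro n x hx
    have h : (K n).orthogonalProjectionOnto x ∈ (Submodule.span ℂ (Set.range (v n)))ᗮ := by
      rw [Submodule.mem_orthogonal]
      intro y hy
      induction hy using Submodule.span_induction with
      | mem y hy =>
        obtain ⟨m, rfl⟩ := hy
        rw [Submodule.inner_orthogonalProjectionOnto_eq_of_mem_left]
        exact hx m
      | zero => exact inner_zero_left _
      | add y z _ _ hy hz => rw [inner_add_left, hy, hz, add_zero]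
      | smul a y _ hy => rw [inner_smul_left, hy, mul_zero]
    rw [hvbot, Submodule.mem_bot] at h
    exact Submodule.orthogonalProjectionOnto_eq_zero_iff.1 h
  have hbot : ∀ x, (∀ p, inner ℂ (g p) x = 0) → x = 0 := by
    intro x hx
    have : x ∈ (⨆ n, K n)ᗮ := by
      rw [← Submodule.iInf_orthogonal, Submodule.mem_iInf]
      exact fun n => hperp n x fun m => hx (n, m)
    rwa [htop, Submodule.mem_bot] at this
  have hspan : ∀ φ : ℕ ≃ ℤ × ℕ, (Submodule.span ℂ (Set.range (g ∘ φ)))ᗮ = ⊥ := by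
    intro φ
    rw [eq_bot_iff, φ.surjective.range_comp]
    intro x hx
    refine hbot x fun p => ?_
    exact (Submodule.mem_orthogonal _ _).1 hx _ (Submodule.subset_span ⟨p, rfl⟩)
  -- `φ` lists the array in the order of `Nat.pair`, and `ψ` is the same list with every row index
  -- raised by one. Sending `e i` to `e' i` is therefore the row shift.
  let z : ℕ ≃ ℤ := (Denumerable.eqv ℤ).symm
  let φ : ℕ ≃ ℤ × ℕ := Nat.pairEquiv.symm.trans (z.prodCongr (Equiv.refl ℕ))
  let ψ : ℕ ≃ ℤ × ℕ := φ.trans ((Equiv.addRight (1 : ℤ)).prodCongr (Equiv.refl ℕ))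
  let e := HilbertBasis.mkOfOrthogonalEqBot (hg.comp φ φ.injective) (hspan φ)
  let e' := HilbertBasis.mkOfOrthogonalEqBot (hg.comp ψ ψ.injective) (hspan ψ)
  have he : ∀ i, e i = g (φ i) := congrFun (HilbertBasis.coe_mkOfOrthogonalEqBot _ _)
  have he' : ∀ i, e' i = g (ψ i) := congrFun (HilbertBasis.coe_mkOfOrthogonalEqBot _ _)
  let U : H ≃ₗᵢ[ℂ] H := e.repr.trans e'.repr.symm
  have hUe : ∀ i, U (e i) = e' i := fun i => by
    simp only [U, LinearIsometryEquiv.trans_apply, HilbertBasis.repr_self,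
      HilbertBasis.repr_symm_single]
  have hUg : ∀ n m, U (g (n, m)) = g (n + 1, m) := fun n m => by
    have h := hUe (φ.symm (n, m))
    rw [he, he', Equiv.apply_symm_apply] at h
    rw [h]
    simp only [ψ, Equiv.trans_apply, Equiv.apply_symm_apply]
    rfl
  have hinner : ∀ n m x, inner ℂ (g (n + 1, m)) (U x) = inner ℂ (g (n, m)) x := fun n m x => by
    rw [← hUg, U.inner_map_map]
  have hUperp : ∀ n, ∀ x ∈ (K n)ᗮ, U x ∈ (K (n + 1))ᗮ := fun n x hx =>
    hperp _ _ fun m => by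
      rw [hinner]
      exact (Submodule.mem_orthogonal _ _).1 hx _ (hmem (n, m))
  refine ⟨U, isUnitarySpread_of_rows e (fun k => z.symm (z k + 1))
    (Unitary.linearIsometryEquiv.symm U).2 fun k m => ?_, fun n => ⟨fun x hx => ?_, hUperp n⟩⟩
  · change U _ = _
    rw [he, he]
    simp [φ, hUg]
  -- The residual is orthogonal to row `n + 1` by projection, and to every other row because `U`
  -- carries the row before it there.
  · have h : U x - (K (n + 1)).starProjection (U x) = 0 := by
      refine hbot _ fun p => ?_
      by_cases hp : p.1 = n + 1
      · exact (Submodule.mem_orthogonal _ _).1 (Submodule.sub_starProjection_mem_orthogonal _) _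
          (hp ▸ hmem p)
      · obtain ⟨j, m⟩ := p
        obtain ⟨i, rfl⟩ : ∃ i, j = i + 1 := ⟨j - 1, by ring⟩
        rw [inner_sub_right, hinner, (horth i n (by simpa using hp)).inner_eq (hmem (i, m)) hx,
          (horth _ _ hp).inner_eq (hmem (i + 1, m)) (Submodule.starProjection_apply_mem _ _),
          sub_zero]
    rw [sub_eq_zero.1 h]
    exact Submodule.starProjection_apply_mem _ _

end ShiftSpread

/-! ### Interval sequences accumulating at a prescribed radius -/

section Intervals

/-- Pairwise disjoint intervals `[c n, d n]` in `(l, m)` tailored to a set `S` of radii: the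
products `∏ d k / r` are square-summable for `r ∈ S`, and a radius `r ∉ S` eventually lies below
the intervals. -/
structure IsRadiusCutoff (c d : ℕ → ℝ) (l m : ℝ) (S : Set ℝ) : Prop where
  left_lt : ∀ n, l < c n
  lt : ∀ n, c n < d n
  lt_right : ∀ n, d n < m
  disjoint : ∀ i j, i < j → d i < c j ∨ d j < c i
  summable : ∀ r ∈ S, Summable fun n => (∏ k ∈ Finset.range n, d k / r) ^ 2
  eventually_le : ∀ r, 0 < r → r ∉ S → ∀ᶠ n in atTop, r ≤ c n

/-- The intervals descend to `a` along `h`, which has `h 1 = m`. For `r > a` the ratio test applies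
with limit `(a / r) ^ 2 < 1`; for `r ≤ a` every interval lies above `r`. -/
theorem exists_isRadiusCutoff_Ioi {l a m : ℝ} (hl : 0 < l) (hla : l ≤ a) (ham : a < m) :
    ∃ c d : ℕ → ℝ, IsRadiusCutoff c d l m (Set.Ioi a) := by
  let h : ℝ → ℝ := fun x => a + (m - a) / x
  have hma : 0 < m - a := sub_pos.2 ham
  have hanti : ∀ x y : ℝ, 0 < x → x < y → h y < h x := fun x y hx hxy =>
    add_lt_add_right (div_lt_div_of_pos_left hma hx hxy) a
  have hah : ∀ x : ℝ, 0 < x → a < h x := fun x hx => lt_add_of_pos_right a (div_pos hma hx)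
  have hd : Tendsto (fun n : ℕ => h (2 * n + 2)) atTop (𝓝 a) := by
    have : Tendsto (fun n : ℕ => (2 * n + 2 : ℝ)) atTop atTop :=
      tendsto_atTop_add_const_right _ _
        (tendsto_natCast_atTop_atTop.const_mul_atTop (by norm_num))
    simpa using (this.const_div_atTop (m - a)).const_add a
  refine ⟨fun n => h (2 * n + 3), fun n => h (2 * n + 2),
    ⟨fun n => hla.trans_lt (hah _ (by positivity)),
    fun n => hanti _ _ (by positivity) (by linarith), fun n => ?_, fun i j hij => Or.inr ?_, ?_, ?_⟩⟩
  · calc h (2 * n + 2) < h 1 := hanti _ _ one_pos (by have : (0 : ℝ) ≤ n := n.cast_nonneg; linarith)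
      _ = m := by simp [h]
  · have : (i + 1 : ℝ) ≤ j := by exact_mod_cast hij
    exact hanti _ _ (by positivity) (by linarith)
  · intro r hr
    have ha : 0 < a := hl.trans_le hla
    have hr0 : 0 < r := ha.trans hr
    have hpos : ∀ n : ℕ, 0 < h (2 * n + 2) / r := fun n =>
      div_pos (ha.trans (hah _ (by positivity))) hr0
    refine summable_of_ratio_test_tendsto_lt_one (l := (a / r) ^ 2) ?_
      (Eventually.of_forall fun n => ?_) ?_
    · exact pow_lt_one₀ (div_pos ha hr0).le ((div_lt_one hr0).2 hr) two_ne_zero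
    · exact pow_ne_zero _ (Finset.prod_ne_zero_iff.2 fun k _ => (hpos k).ne')
    · refine ((hd.div_const r).pow 2).congr fun n => ?_
      have : ∏ k ∈ Finset.range n, h (2 * k + 2) / r ≠ 0 :=
        Finset.prod_ne_zero_iff.2 fun k _ => (hpos k).ne'
      rw [Finset.prod_range_succ, ← norm_div, ← div_pow, mul_div_cancel_left₀ _ this,
        Real.norm_of_nonneg (by positivity)]
  · intro r _ hr
    exact Eventually.of_forall fun n => (not_lt.1 hr).trans (hah _ (by positivity)).le

/-- The intervals now rise to `a`, with right endpoints chosen so that the product telescopes at `r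
= a` to `M / (n + M)`, which is square-summable. For `r < a` they eventually pass `r`. Staying above
`l` while below `a` requires `l < a`. -/
theorem exists_isRadiusCutoff_Ici {l a m : ℝ} (hl : 0 < l) (hla : l < a) (ham : a < m) :
    ∃ c d : ℕ → ℝ, IsRadiusCutoff c d l m (Set.Ici a) := by
  have ha : 0 < a := hl.trans hla
  let h : ℝ → ℝ := fun x => a * (x / (x + 1))
  have hmono : ∀ x y : ℝ, 0 < x → x < y → h x < h y := fun x y hx hxy => by
    refine mul_lt_mul_of_pos_left ((div_lt_div_iff₀ (by linarith) (by linarith)).2 ?_) ha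
    linarith
  have hha : ∀ x : ℝ, 0 < x → h x < a := fun x hx =>
    mul_lt_of_lt_one_right ha ((div_lt_one (by linarith)).2 (by linarith))
  have hlim : Tendsto h atTop (𝓝 a) := by
    have h1 : Tendsto (fun x : ℝ => a * (1 - 1 / (x + 1))) atTop (𝓝 (a * (1 - 0))) :=
      ((tendsto_const_nhds.div_atTop (tendsto_atTop_add_const_right _ _ tendsto_id)).const_sub
        1).const_mul a
    rw [sub_zero, mul_one] at h1
    refine h1.congr' ((eventually_gt_atTop 0).mono fun x hx => ?_)
    have : x + 1 ≠ 0 := by positivity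
    simp only [h]
    field_simp
    ring
  -- The offset `N` starts the sequence late enough for all intervals to lie above `l`.
  obtain ⟨N, hN0, hN⟩ : ∃ N : ℝ, 0 < N ∧ l < h N :=
    ((eventually_gt_atTop 0).and (hlim.eventually_const_lt hla)).exists
  have hc : Tendsto (fun n : ℕ => h (n + N)) atTop (𝓝 a) :=
    hlim.comp (tendsto_atTop_add_const_right _ _ tendsto_natCast_atTop_atTop)
  refine ⟨fun n => h (n + N), fun n => h (n + (N + 1 / 2)), ⟨fun n => hN.trans_le ?_,
    fun n => hmono _ _ (by positivity) (by linarith), fun n => (hha _ (by positivity)).trans ham,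
    fun i j hij => Or.inl ?_, ?_, ?_⟩⟩
  · rcases n.eq_zero_or_pos with rfl | hn
    · simp
    · exact (hmono _ _ hN0 (by simpa using hn)).le
  · have : (i + 1 : ℝ) ≤ j := by exact_mod_cast hij
    exact hmono _ _ (by positivity) (by linarith)
  · intro r hr
    have hr0 : 0 < r := ha.trans_le hr
    set M := N + 1 / 2
    have hM : 0 < M := by positivity
    have hpos : ∀ n : ℕ, 0 ≤ h (n + M) / r := fun n => by positivity
    have hprod : ∀ n : ℕ, ∏ k ∈ Finset.range n, h (k + M) / r ≤ M / (n + M) := by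
      intro n
      induction n with
      | zero => simp [hM.ne']
      | succ n ih =>
        rw [Finset.prod_range_succ]
        have h1 : h (n + M) / r ≤ (n + M) / (n + M + 1) := by
          rw [div_le_iff₀ hr0, mul_comm]
          exact mul_le_mul_of_nonneg_right hr (by positivity)
        refine (mul_le_mul ih h1 (hpos n) (by positivity)).trans_eq ?_
        have : (n + M : ℝ) ≠ 0 := by positivity
        have : (n + M + 1 : ℝ) ≠ 0 := by positivity
        push_cast
        field_simp
        ring
    refine Summable.of_nonneg_of_le (fun n => sq_nonneg _)
      (fun n => pow_le_pow_left₀ (Finset.prod_nonneg fun k _ => hpos k) (hprod n) 2) ?_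
    rw [← summable_nat_add_iff 1]
    have hsum : Summable fun n : ℕ => M ^ 2 * (1 / ((n + 1 : ℕ) : ℝ) ^ 2) :=
      ((summable_nat_add_iff 1).2 (Real.summable_one_div_nat_pow.2 one_lt_two)).mul_left _
    refine hsum.of_nonneg_of_le (fun n => sq_nonneg _) fun n => ?_
    rw [div_pow, div_eq_mul_one_div]
    have : (0 : ℝ) < ((n + 1 : ℕ) : ℝ) := by positivity
    gcongr
    linarith
  · intro r _ hr
    exact (hc.eventually_const_lt (not_le.1 hr)).mono fun _ => le_of_lt

end Intervals

/-! ### Eigenvectors of block-weighted bilateral shifts -/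

section WeightedShift

theorem exists_eq_zero_of_eventually_le_succ {u : ℕ → ℝ} (hu : ∀ k, 0 ≤ u k)
    (hlim : Tendsto u atTop (𝓝 0)) (hle : ∀ᶠ k in atTop, u k ≤ u (k + 1)) : ∃ k, u k = 0 := by
  obtain ⟨k, hk⟩ := eventually_atTop.1 hle
  have hmono : ∀ j ≥ k, u k ≤ u j := fun j hj => by
    induction j, hj using Nat.le_induction with
    | base => exact le_rfl
    | succ j hj ih => exact ih.trans (hk j hj)
  exact ⟨k, le_antisymm (ge_of_tendsto hlim (eventually_atTop.2 ⟨k, hmono⟩)) (hu k)⟩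

theorem summable_sq_of_le_mul {u t : ℕ → ℝ} (hu : ∀ k, 0 ≤ u k) (ht : ∀ k, 0 ≤ t k)
    (hle : ∀ k, u (k + 1) ≤ t k * u k)
    (hsum : Summable fun n => (∏ k ∈ Finset.range n, t k) ^ 2) : Summable fun k => u k ^ 2 := by
  have h : ∀ n, u n ≤ (∏ k ∈ Finset.range n, t k) * u 0 := fun n => by
    induction n with
    | zero => simp
    | succ n ih =>
      rw [Finset.prod_range_succ, mul_right_comm, mul_comm _ (t n)]
      exact (hle n).trans (mul_le_mul_of_nonneg_left ih (ht n))
  refine (hsum.mul_right (u 0 ^ 2)).of_nonneg_of_le (fun n => sq_nonneg _) fun n => ?_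
  rw [← mul_pow]
  exact pow_le_pow_left₀ (hu n) (h n) 2

variable {H : Type*} [NormedAddCommGroup H] [InnerProductSpace ℂ H]

/-- Bessel's inequality: for a finite sum `s` of projections of `x`, `‖s‖ ^ 2 = ⟨s, x⟩ ≤ ‖s‖ ‖x‖`.
-/
theorem summable_norm_sq_starProjection {ι : Type*} {K : ι → Submodule ℂ H}
    [∀ n, (K n).HasOrthogonalProjection] (horth : ∀ i j, i ≠ j → K i ⟂ K j) (x : H) :
    Summable fun n => ‖(K n).starProjection x‖ ^ 2 := by
  refine summable_of_sum_le (c := ‖x‖ ^ 2) (fun n => sq_nonneg _) fun s => ?_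
  set t := ∑ n ∈ s, ‖(K n).starProjection x‖ ^ 2
  have h1 : ‖∑ n ∈ s, (K n).starProjection x‖ ^ 2 = t := by
    have hfam : OrthogonalFamily ℂ (fun n => K n) fun n => (K n).subtypeₗᵢ :=
      fun i j hij v w => (horth i j hij).inner_eq v.2 w.2
    exact hfam.norm_sum (fun n => ⟨_, (K n).starProjection_apply_mem x⟩) s
  have h2 : inner ℂ (∑ n ∈ s, (K n).starProjection x) x = (t : ℂ) := by
    rw [sum_inner, Complex.ofReal_sum]
    refine Finset.sum_congr rfl fun n _ => ?_
    have h3 : inner ℂ ((K n).starProjection x) (x - (K n).starProjection x) = 0 :=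
      (Submodule.mem_orthogonal _ _).1 (Submodule.sub_starProjection_mem_orthogonal x) _
        ((K n).starProjection_apply_mem x)
    rw [inner_sub_right, sub_eq_zero] at h3
    rw [h3, inner_self_eq_norm_sq_to_K]
    norm_cast
  have h3 : t ≤ ‖∑ n ∈ s, (K n).starProjection x‖ * ‖x‖ := by
    have := norm_inner_le_norm (𝕜 := ℂ) (∑ n ∈ s, (K n).starProjection x) x
    rw [h2, Complex.norm_real] at this
    exact (le_abs_self t).trans this
  rw [← h1] at h3 ⊢
  nlinarith [norm_nonneg (∑ n ∈ s, (K n).starProjection x), norm_nonneg x,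
    sq_nonneg (‖∑ n ∈ s, (K n).starProjection x‖ - ‖x‖)]

variable {K : ℤ → Submodule ℂ H} [∀ n, (K n).HasOrthogonalProjection] {T : H →L[ℂ] H}

theorem eq_zero_of_starProjection_eq_zero (htop : (⨆ n, K n)ᗮ = ⊥) {x : H}
    (hx : ∀ n, (K n).starProjection x = 0) : x = 0 := by
  have : x ∈ (⨆ n, K n)ᗮ := by
    rw [← Submodule.iInf_orthogonal, Submodule.mem_iInf]
    exact fun n => (K n).starProjection_apply_eq_zero_iff.1 (hx n)
  rwa [htop, Submodule.mem_bot] at this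

theorem norm_starProjection_succ
    (hTP : ∀ n x, (K (n + 1)).starProjection (T x) = T ((K n).starProjection x))
    {μ : ℂ} {x : H} (hx : T x = μ • x) (n : ℤ) :
    ‖T ((K n).starProjection x)‖ = ‖μ‖ * ‖(K (n + 1)).starProjection x‖ := by
  rw [← hTP, hx, map_smul, norm_smul]

/-- A component of an eigenvector can only vanish if the whole eigenvector does. -/
theorem eq_zero_of_starProjection_eq_zero_of_shift (htop : (⨆ n, K n)ᗮ = ⊥)
    (hT : Function.Injective T)
    (hTP : ∀ n x, (K (n + 1)).starProjection (T x) = T ((K n).starProjection x))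
    {μ : ℂ} (hμ : μ ≠ 0) {x : H} (hx : T x = μ • x) (m : ℤ) (hm : (K m).starProjection x = 0) :
    x = 0 := by
  refine eq_zero_of_starProjection_eq_zero htop fun n => ?_
  have h := norm_starProjection_succ hTP hx
  induction n using Int.inductionOn' (b := m) with
  | zero => exact hm
  | succ k _ ih =>
    have := h k
    rw [ih, map_zero, norm_zero, zero_eq_mul] at this
    exact norm_eq_zero.1 (this.resolve_left (norm_ne_zero_iff.2 hμ))
  | pred k _ ih =>
    have := h (k - 1)
    rw [sub_add_cancel, ih, norm_zero, mul_zero, norm_eq_zero, map_eq_zero_iff _ hT] at this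
    exact this

variable {c d c' d' : ℕ → ℝ} {S S' : Set ℝ} {l m l' m' : ℝ}

/-- If `‖μ‖ ∉ S`, eventually `‖μ‖ ≤ c n`, so the component norms of `x` stop decreasing to the
right. They tend to zero by Bessel, so some component vanishes, and with it `x`. -/
theorem mem_of_isRadiusCutoff_right (horth : ∀ i j, i ≠ j → K i ⟂ K j) (htop : (⨆ n, K n)ᗮ = ⊥)
    (hT : Function.Injective T)
    (hTP : ∀ n x, (K (n + 1)).starProjection (T x) = T ((K n).starProjection x))
    (hS : IsRadiusCutoff c d l m S) (hlow : ∀ n : ℕ, ∀ x ∈ K (n + 1), c n * ‖x‖ ≤ ‖T x‖)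
    {μ : ℂ} (hμ : μ ≠ 0) {x : H} (hx0 : x ≠ 0) (hx : T x = μ • x) : ‖μ‖ ∈ S := by
  by_contra hS'
  have hlim : Tendsto (fun k : ℕ => ‖(K (k + 1)).starProjection x‖ ^ 2) atTop (𝓝 0) :=
    ((summable_norm_sq_starProjection horth x).comp_injective
      (i := fun k : ℕ => (k + 1 : ℤ)) fun _ _ h => by simpa using h).tendsto_atTop_zero
  have hpos : 0 < ‖μ‖ := norm_pos_iff.2 hμ
  obtain ⟨k, hk⟩ := exists_eq_zero_of_eventually_le_succ (fun _ => sq_nonneg _) hlim <| by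
    filter_upwards [hS.eventually_le _ hpos hS'] with k hk
    have h1 := hlow k _ ((K (k + 1)).starProjection_apply_mem x)
    rw [norm_starProjection_succ hTP hx] at h1
    have h2 := (mul_le_mul_of_nonneg_right hk (norm_nonneg _)).trans h1
    have h3 := le_of_mul_le_mul_left h2 hpos
    push_cast
    exact pow_le_pow_left₀ (norm_nonneg _) h3 2
  exact hx0 (eq_zero_of_starProjection_eq_zero_of_shift htop hT hTP hμ hx (k + 1)
    (by simpa using hk))

/-- The mirror argument: a step to the left applies `T⁻¹` and multiplies by `μ`, so radii enter
inverted. -/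
theorem mem_of_isRadiusCutoff_left (horth : ∀ i j, i ≠ j → K i ⟂ K j) (htop : (⨆ n, K n)ᗮ = ⊥)
    (hT : Function.Injective T)
    (hTP : ∀ n x, (K (n + 1)).starProjection (T x) = T ((K n).starProjection x))
    (hl : 0 < l') (hS : IsRadiusCutoff c' d' l' m' S')
    (hup : ∀ n : ℕ, ∀ x ∈ K (-(n + 1)), ‖T x‖ ≤ (c' n)⁻¹ * ‖x‖)
    {μ : ℂ} (hμ : μ ≠ 0) {x : H} (hx0 : x ≠ 0) (hx : T x = μ • x) : ‖μ‖⁻¹ ∈ S' := by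
  by_contra hS'
  have hlim : Tendsto (fun k : ℕ => ‖(K (-k)).starProjection x‖ ^ 2) atTop (𝓝 0) :=
    ((summable_norm_sq_starProjection horth x).comp_injective
      (i := fun k : ℕ => (-k : ℤ)) fun _ _ h => by simpa using h).tendsto_atTop_zero
  have hpos : 0 < ‖μ‖ := norm_pos_iff.2 hμ
  obtain ⟨k, hk⟩ := exists_eq_zero_of_eventually_le_succ (fun _ => sq_nonneg _) hlim <| by
    filter_upwards [hS.eventually_le _ (inv_pos.2 hpos) hS'] with k hk
    have hc : 0 < c' k := hl.trans (hS.left_lt k)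
    have h1 := hup k _ ((K (-(k + 1))).starProjection_apply_mem x)
    rw [norm_starProjection_succ hTP hx, show (-(k + 1) + 1 : ℤ) = -k by ring] at h1
    have h2 := h1.trans (mul_le_mul_of_nonneg_right
      ((inv_le_comm₀ hpos hc).1 hk) (norm_nonneg _))
    have h3 := le_of_mul_le_mul_left h2 hpos
    push_cast
    exact pow_le_pow_left₀ (norm_nonneg _) h3 2
  exact hx0 (eq_zero_of_starProjection_eq_zero_of_shift htop hT hTP hμ hx (-k)
    (by simpa using hk))

theorem mem_of_apply_mem_of_shift (htop : (⨆ n, K n)ᗮ = ⊥)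
    (hT : Function.Injective T)
    (hTP : ∀ n x, (K (n + 1)).starProjection (T x) = T ((K n).starProjection x))
    {n : ℤ} {x : H} (hx : T x ∈ K (n + 1)) : x ∈ K n := by
  have h : x - (K n).starProjection x = 0 := by
    refine eq_zero_of_starProjection_eq_zero htop fun i => hT ?_
    rw [← hTP, map_sub, ← hTP, Submodule.starProjection_eq_self_iff.2 hx, sub_self]
    simp
  rw [sub_eq_zero.1 h]
  exact (K n).starProjection_apply_mem x

/-- The eigenvector is `∑ (μ⁻¹ T) ^ n v` over `n ∈ ℤ`, for a nonzero `v ∈ K 0`. Its terms are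
orthogonal with square-summable norms, so it converges; `T` shifts the series up to the factor `μ`,
and its `K 0` component is `v`. -/
theorem exists_eigenvector_of_isRadiusCutoff [CompleteSpace H]
    (horth : ∀ i j, i ≠ j → K i ⟂ K j) (htop : (⨆ n, K n)ᗮ = ⊥) (hT : IsUnit T)
    (hTP : ∀ n x, (K (n + 1)).starProjection (T x) = T ((K n).starProjection x))
    (hl : 0 < l) (hl' : 0 < l') (hS : IsRadiusCutoff c d l m S)
    (hS' : IsRadiusCutoff c' d' l' m' S')
    (hup : ∀ n : ℕ, ∀ x ∈ K (n + 1), ‖T x‖ ≤ d n * ‖x‖)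
    (hlow : ∀ n : ℕ, ∀ x ∈ K (-(n + 1)), (d' n)⁻¹ * ‖x‖ ≤ ‖T x‖) (hK : K 0 ≠ ⊥)
    {μ : ℂ} (hμ : μ ≠ 0) (hμS : ‖μ‖ ∈ S) (hμS' : ‖μ‖⁻¹ ∈ S') : ∃ x : H, x ≠ 0 ∧ T x = μ • x := by
  obtain ⟨v, hv, hv0⟩ := (K 0).ne_bot_iff.1 hK
  obtain ⟨W, rfl⟩ := hT
  have hinj : Function.Injective (W : H →L[ℂ] H) := fun x y h => by
    have := congrArg (fun z => ((W⁻¹ : (H →L[ℂ] H)ˣ) : H →L[ℂ] H) z) h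
    simpa [← mul_apply_eq_comp] using this
  have hpos : 0 < ‖μ‖ := norm_pos_iff.2 hμ
  let V : (H →L[ℂ] H)ˣ := (Units.mk0 μ hμ)⁻¹ • W
  have hV : ∀ x, (W : H →L[ℂ] H) x = μ • (V : H →L[ℂ] H) x := fun x => by
    change _ = μ • (μ⁻¹ • (W : H →L[ℂ] H) x)
    rw [smul_inv_smul₀ hμ]
  let y : ℤ → H := fun n => ((V ^ n : (H →L[ℂ] H)ˣ) : H →L[ℂ] H) v
  have hy0 : y 0 = v := by simp [y]
  have hy : ∀ n, (W : H →L[ℂ] H) (y n) = μ • y (n + 1) := fun n => by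
    rw [hV]
    simp only [y]
    rw [add_comm n 1, zpow_one_add, Units.val_mul, mul_apply_eq_comp]
  have hmem : ∀ n, y n ∈ K n := fun n => by
    induction n using Int.inductionOn' (b := 0) with
    | zero => rwa [hy0]
    | succ k _ ih =>
      have h1 : (W : H →L[ℂ] H) (y k) ∈ K (k + 1) := by
        rw [← Submodule.starProjection_eq_self_iff, hTP, Submodule.starProjection_eq_self_iff.2 ih]
      rw [hy] at h1
      exact ((K (k + 1)).smul_mem_iff hμ).1 h1
    | pred k _ ih =>
      refine mem_of_apply_mem_of_shift htop hinj hTP ?_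
      rw [hy, sub_add_cancel]
      exact (K k).smul_mem _ ih
  have hynorm : ∀ n, ‖(W : H →L[ℂ] H) (y n)‖ = ‖μ‖ * ‖y (n + 1)‖ := fun n => by
    rw [hy, norm_smul]
  -- This starts at `y 1`, since the step out of `K 0` has no norm bound. The left half can start at
  -- `y 0`, because its first step is governed by the bound on `K (-1)`.
  have hright : Summable fun k : ℕ => ‖y (k + 1)‖ ^ 2 := by
    refine summable_sq_of_le_mul (fun _ => norm_nonneg _) (fun k => ?_) (fun k => ?_)
      (hS.summable _ hμS)
    · exact div_nonneg (hl.trans ((hS.left_lt k).trans (hS.lt k))).le hpos.le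
    · have h := hup k _ (hmem (k + 1))
      rw [hynorm] at h
      rw [div_mul_eq_mul_div, le_div_iff₀ hpos, mul_comm]
      push_cast
      exact h
  have hleft : Summable fun k : ℕ => ‖y (-k)‖ ^ 2 := by
    have hd : ∀ k, 0 < d' k := fun k => hl'.trans ((hS'.left_lt k).trans (hS'.lt k))
    refine summable_sq_of_le_mul (fun _ => norm_nonneg _) (fun k => ?_) (fun k => ?_)
      (hS'.summable _ hμS')
    · exact div_nonneg (hd k).le (inv_nonneg.2 hpos.le)
    · have h := hlow k _ (hmem (-(k + 1)))
      rw [hynorm, show (-(k + 1) + 1 : ℤ) = -k by ring, inv_mul_le_iff₀ (hd k)] at h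
      rw [div_inv_eq_mul, mul_assoc]
      push_cast
      exact h
  have hsq : Summable fun n : ℤ => ‖y n‖ ^ 2 :=
    .of_nat_of_neg ((summable_nat_add_iff (f := fun k : ℕ => ‖y k‖ ^ 2) 1).1 (by
      push_cast; exact hright)) hleft
  have hfam : OrthogonalFamily ℂ (fun n => K n) fun n => (K n).subtypeₗᵢ :=
    fun i j hij v w => (horth i j hij).inner_eq v.2 w.2
  obtain ⟨x, hx⟩ : Summable y :=
    (hfam.summable_iff_norm_sq_summable fun n => ⟨y n, hmem n⟩).2 hsq
  refine ⟨x, fun hx0 => hv0 ?_, ?_⟩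
  · have h1 := hx.mapL ((K 0).starProjection)
    have h2 : HasSum (fun n => (K 0).starProjection (y n)) v := by
      have : (K 0).starProjection (y 0) = v := by
        rw [Submodule.starProjection_eq_self_iff.2 (hmem 0), hy0]
      rw [← this]
      refine hasSum_single 0 fun n hn => ?_
      rw [Submodule.starProjection_apply_eq_zero_iff]
      exact (horth n 0 hn) (hmem n)
    rw [h2.unique h1, hx0, map_zero]
  · have h1 := hx.mapL (W : H →L[ℂ] H)
    simp only [hy] at h1
    exact h1.unique (((Equiv.addRight (1 : ℤ)).hasSum_iff.2 hx).const_smul μ)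

end WeightedShift

/-! ### Decomposition of the space and choice of radii -/

section Assembly

/-- Endpoints of a doubly infinite family of intervals: `[a, b]` at `0`, the intervals `[c k, d k]`
to the right and the inverted intervals `[(d' k)⁻¹, (c' k)⁻¹]` to the left. -/
noncomputable def joinedEndpoint (a : ℝ) (c d' : ℕ → ℝ) : ℤ → ℝ
  | Int.ofNat 0 => a
  | Int.ofNat (k + 1) => c k
  | Int.negSucc k => (d' k)⁻¹

theorem joinedEndpoint_bounds {c d c' d' : ℕ → ℝ} {S S' : Set ℝ} {l₁ l₂ m₁ m₂ : ℝ}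
    (hl₁ : 0 < l₁) (hl₂ : 0 < l₂) (hm₁ : l₁ ≤ m₁) (hm : m₁ < m₂) (hm₂ : m₂ ≤ l₂)
    (hS : IsRadiusCutoff c d l₁ m₁ S) (hS' : IsRadiusCutoff c' d' l₂⁻¹ m₂⁻¹ S') (n : ℤ) :
    l₁ ≤ joinedEndpoint m₁ c d' n ∧ joinedEndpoint m₁ c d' n < joinedEndpoint m₂ d c' n ∧
      joinedEndpoint m₂ d c' n ≤ l₂ := by
  have hc' : ∀ k, 0 < c' k := fun k => (inv_pos.2 hl₂).trans (hS'.left_lt k)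
  have hd' : ∀ k, 0 < d' k := fun k => (hc' k).trans (hS'.lt k)
  match n with
  | Int.ofNat 0 => exact ⟨hm₁, hm, hm₂⟩
  | Int.ofNat (k + 1) =>
    exact ⟨(hS.left_lt k).le, hS.lt k, ((hS.lt_right k).trans (hm.trans_le hm₂)).le⟩
  | Int.negSucc k =>
    refine ⟨?_, inv_strictAnti₀ (hc' k) (hS'.lt k), (inv_lt_of_inv_lt₀ hl₂ (hS'.left_lt k)).le⟩
    exact (hm₁.trans hm.le).trans
      ((le_inv_comm₀ (hd' k) (hl₁.trans_le (hm₁.trans hm.le))).1 (hS'.lt_right k).le)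

theorem joinedEndpoint_disjoint {c d c' d' : ℕ → ℝ} {S S' : Set ℝ} {l₁ l₂ m₁ m₂ : ℝ}
    (hl₂ : 0 < l₂) (hm₂0 : 0 < m₂) (hm : m₁ < m₂)
    (hS : IsRadiusCutoff c d l₁ m₁ S) (hS' : IsRadiusCutoff c' d' l₂⁻¹ m₂⁻¹ S') {i j : ℤ}
    (hij : i ≠ j) :
    joinedEndpoint m₂ d c' i < joinedEndpoint m₁ c d' j ∨
      joinedEndpoint m₂ d c' j < joinedEndpoint m₁ c d' i := by
  have hc' : ∀ k, 0 < c' k := fun k => (inv_pos.2 hl₂).trans (hS'.left_lt k)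
  have hd' : ∀ k, 0 < d' k := fun k => (hc' k).trans (hS'.lt k)
  have hm' : ∀ k, m₂ < (d' k)⁻¹ := fun k => (lt_inv_comm₀ (hd' k) hm₂0).1 (hS'.lt_right k)
  have hdisj : ∀ i j, i ≠ j → d i < c j ∨ d j < c i := fun i j h =>
    h.lt_or_gt.elim (hS.disjoint i j) fun h => (hS.disjoint j i h).symm
  have hdisj' : ∀ i j, i ≠ j → d' i < c' j ∨ d' j < c' i := fun i j h =>
    h.lt_or_gt.elim (hS'.disjoint i j) fun h => (hS'.disjoint j i h).symm
  match i, j with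
  | Int.ofNat 0, Int.ofNat 0 => exact absurd rfl hij
  | Int.ofNat 0, Int.ofNat (k + 1) => exact Or.inr (hS.lt_right k)
  | Int.ofNat (k + 1), Int.ofNat 0 => exact Or.inl (hS.lt_right k)
  | Int.ofNat 0, Int.negSucc k => exact Or.inl (hm' k)
  | Int.negSucc k, Int.ofNat 0 => exact Or.inr (hm' k)
  | Int.ofNat (k + 1), Int.negSucc k' => exact Or.inl ((hS.lt_right k).trans (hm.trans (hm' k')))
  | Int.negSucc k', Int.ofNat (k + 1) => exact Or.inr ((hS.lt_right k).trans (hm.trans (hm' k')))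
  | Int.ofNat (k + 1), Int.ofNat (k' + 1) => exact hdisj k k' fun h => hij (by rw [h])
  | Int.negSucc k, Int.negSucc k' =>
    exact (hdisj' k k' fun h => hij (by rw [h])).symm.imp (inv_strictAnti₀ (hd' k'))
      (inv_strictAnti₀ (hd' k))

variable {H : Type*} [NormedAddCommGroup H] [InnerProductSpace ℂ H]

theorem mem_pointSpectrum {T : H →L[ℂ] H} {μ : ℂ} :
    μ ∈ pointSpectrum T ↔ ∃ x : H, x ≠ 0 ∧ T x = μ • x := by
  refine ⟨fun h => ?_, fun ⟨x, hx0, hx⟩ =>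
    Module.End.hasEigenvalue_of_hasEigenvector ⟨Module.End.mem_eigenspace_iff.2 hx, hx0⟩⟩
  obtain ⟨x, hx⟩ := Module.End.HasEigenvalue.exists_hasEigenvector h
  exact ⟨x, hx.2, hx.apply_eq_smul⟩

variable [CompleteSpace H]

theorem apply_mem_orthogonal {A : H →L[ℂ] H} (hA : IsSelfAdjoint A) {K : Submodule ℂ H}
    (hinv : ∀ x ∈ K, A x ∈ K) {x : H} (hx : x ∈ Kᗮ) : A x ∈ Kᗮ := by
  rw [Submodule.mem_orthogonal]
  intro y hy
  rw [← ContinuousLinearMap.adjoint_inner_left, ← ContinuousLinearMap.star_eq_adjoint, hA.star_eq]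
  exact (Submodule.mem_orthogonal _ _).1 hx _ (hinv y hy)

/-- The spectral subspaces of disjoint intervals `[p n, q n]`, with the one at `0` enlarged so that
they fill the space. -/
theorem exists_orthogonal_decomposition {A : H →L[ℂ] H} (hA : IsSelfAdjoint A)
    (hpoint : pointSpectrum A = ∅) {p q : ℤ → ℝ} (hpq : ∀ n, p n < q n)
    (hspec : ∀ n, Set.Icc (p n) (q n) ⊆ spectrum ℝ A)
    (hdisj : ∀ i j, i ≠ j → q i < p j ∨ q j < p i) :
    ∃ K : ℤ → Submodule ℂ H, (∀ n, IsClosed (K n : Set H)) ∧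
      (∀ n, ¬ FiniteDimensional ℂ (K n)) ∧ (∀ i j, i ≠ j → K i ⟂ K j) ∧ (⨆ n, K n)ᗮ = ⊥ ∧
      (∀ n, ∀ x ∈ K n, A x ∈ K n) ∧ ∀ n, n ≠ 0 → K n = intervalSubspace A (p n) (q n) := by
  let E : ℤ → Submodule ℂ H := fun n => intervalSubspace A (p n) (q n)
  let L : Submodule ℂ H := ⨅ (n : ℤ) (_ : n ≠ 0), (E n)ᗮ
  have hmemL : ∀ x, x ∈ L ↔ ∀ n, n ≠ 0 → x ∈ (E n)ᗮ := fun x => by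
    simp only [L, Submodule.mem_iInf]
  have hEE : ∀ i j, i ≠ j → E i ⟂ E j := fun i j hij => by
    rw [Submodule.isOrtho_iff_inner_eq]
    intro x hx y hy
    rcases hdisj i j hij with h | h
    · exact inner_eq_zero_of_mem_intervalSubspace hA h hx hy
    · exact inner_eq_zero_symm.1 (inner_eq_zero_of_mem_intervalSubspace hA h hy hx)
  have hEL : ∀ n, n ≠ 0 → E n ⟂ L := fun n hn =>
    (Submodule.isOrtho_orthogonal_right _).mono_right fun x hx => (hmemL x).1 hx n hn
  have hE0 : E 0 ≤ L := le_iInf₂ fun n hn => hEE 0 n hn.symm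
  have hbot : ∀ n, E n ≠ ⊥ := fun n => intervalSubspace_ne_bot hA (hpq n) (hspec n)
  have hAL : ∀ x ∈ L, A x ∈ L := by
    intro x hx
    rw [hmemL] at hx ⊢
    exact fun n hn => apply_mem_orthogonal hA (fun y hy => apply_mem_intervalSubspace hA hy)
      (hx n hn)
  let K : ℤ → Submodule ℂ H := fun n => if n = 0 then L else E n
  have hK0 : K 0 = L := if_pos rfl
  have hK : ∀ n, n ≠ 0 → K n = E n := fun n hn => if_neg hn
  have hAK : ∀ n, ∀ x ∈ K n, A x ∈ K n := fun n => by
    by_cases hn : n = 0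
    · subst hn; rwa [hK0]
    · rw [hK n hn]
      exact fun x hx => apply_mem_intervalSubspace hA hx
  refine ⟨K, fun n => ?_, fun n => not_finiteDimensional_of_invariant hpoint ?_ (hAK n),
    fun i j hij => ?_, ?_, hAK, hK⟩
  · by_cases hn : n = 0
    · subst hn
      rw [hK0]
      simp only [L, Submodule.coe_iInf]
      exact isClosed_iInter fun n => isClosed_iInter fun _ => Submodule.isClosed_orthogonal _
    · rw [hK n hn]
      exact isClosed_intervalSubspace _ _ _
  · by_cases hn : n = 0
    · subst hn
      rw [hK0]
      exact ne_bot_of_le_ne_bot (hbot 0) hE0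
    · rw [hK n hn]
      exact hbot n
  · by_cases hi : i = 0
    · subst hi
      rw [hK0, hK j hij.symm]
      exact (hEL j hij.symm).symm
    · by_cases hj : j = 0
      · subst hj
        rw [hK0, hK i hi]
        exact hEL i hi
      · rw [hK i hi, hK j hj]
        exact hEE i j hij
  · rw [eq_bot_iff]
    intro x hx
    rw [← Submodule.iInf_orthogonal, Submodule.mem_iInf] at hx
    -- A vector orthogonal to all `K n` with `n ≠ 0` lies in `L = K 0`, so it is orthogonal to
    -- itself.
    have hxL : x ∈ L := (hmemL x).2 fun n hn => hK n hn ▸ hx n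
    have h0 := hx 0
    rw [hK0] at h0
    exact inner_self_eq_zero.1 ((Submodule.mem_orthogonal _ _).1 h0 x hxL)

theorem exists_isUnitarySpread_pointSpectrum [TopologicalSpace.SeparableSpace H]
    {A : H →L[ℂ] H} (hA : IsSelfAdjoint A) (hpoint : pointSpectrum A = ∅)
    {c d c' d' : ℕ → ℝ} {S S' : Set ℝ} {l₁ l₂ m₁ m₂ : ℝ} (hl₁ : 0 < l₁)
    (hm₁ : l₁ ≤ m₁) (hm : m₁ < m₂) (hm₂ : m₂ ≤ l₂) (hspec : spectrum ℝ A = Set.Icc l₁ l₂)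
    (hS : IsRadiusCutoff c d l₁ m₁ S) (hS' : IsRadiusCutoff c' d' l₂⁻¹ m₂⁻¹ S') :
    ∃ U : H →L[ℂ] H, IsUnitarySpread U ∧
      pointSpectrum (U ∘L A) = {μ | μ ≠ 0 ∧ ‖μ‖ ∈ S ∧ ‖μ‖⁻¹ ∈ S'} := by
  have hm₂0 : 0 < m₂ := hl₁.trans_le (hm₁.trans hm.le)
  have hl₂ : 0 < l₂ := hm₂0.trans_le hm₂
  have hbd := joinedEndpoint_bounds hl₁ hl₂ hm₁ hm hm₂ hS hS'
  obtain ⟨K, hclosed, hinf, horth, htop, hAK, hK⟩ := exists_orthogonal_decomposition hA hpoint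
    (fun n => (hbd n).2.1) (fun n => hspec ▸ Set.Icc_subset_Icc (hbd n).1 (hbd n).2.2)
    (fun i j => joinedEndpoint_disjoint hl₂ hm₂0 hm hS hS')
  have (n : ℤ) : CompleteSpace (K n) := (hclosed n).completeSpace_coe
  obtain ⟨U, hU, hUK⟩ := exists_isUnitarySpread_map_eq K hinf horth htop
  have hpos : ∀ n, 0 < joinedEndpoint m₁ c d' n := fun n => hl₁.trans_le (hbd n).1
  have hlow : ∀ n, n ≠ 0 → ∀ x ∈ K n, joinedEndpoint m₁ c d' n * ‖x‖ ≤ ‖U (A x)‖ :=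
    fun n hn x hx => by
      rw [U.norm_map]
      exact le_norm_apply_of_mem_intervalSubspace hA (hpos n) (hK n hn ▸ hx)
  have hup : ∀ n, n ≠ 0 → ∀ x ∈ K n, ‖U (A x)‖ ≤ joinedEndpoint m₂ d c' n * ‖x‖ :=
    fun n hn x hx => by
      rw [U.norm_map]
      exact norm_apply_le_of_mem_intervalSubspace hA (hpos n) (hbd n).2.1.le (hK n hn ▸ hx)
  have hneg : ∀ k : ℕ, Int.negSucc k = -((k : ℤ) + 1) := fun k => Int.negSucc_eq k
  have hAunit : IsUnit A := by
    rw [← spectrum.zero_notMem_iff ℝ, hspec]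
    exact fun h => hl₁.not_ge h.1
  have hUunit : IsUnit (U : H →L[ℂ] H) := (Unitary.toUnits ⟨_, hU.1⟩).isUnit
  set T : H →L[ℂ] H := (U : H →L[ℂ] H) ∘L A
  have hT : IsUnit T := hUunit.mul hAunit
  have hinj : Function.Injective T := by
    obtain ⟨W, hW⟩ := hT
    refine Function.LeftInverse.injective
      (g := ((W⁻¹ : (H →L[ℂ] H)ˣ) : H →L[ℂ] H)) fun x => ?_
    rw [← hW, ← mul_apply_eq_comp, Units.inv_mul]
    rfl
  -- `A` preserves `K n` and its complement, and `U` carries both one index up.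
  have hTP : ∀ n x, (K (n + 1)).starProjection (T x) = T ((K n).starProjection x) := by
    intro n x
    refine Submodule.eq_starProjection_of_mem_orthogonal
      ((hUK n).1 _ (hAK n _ ((K n).starProjection_apply_mem x))) ?_
    rw [← map_sub]
    exact (hUK n).2 _ (apply_mem_orthogonal hA (hAK n)
      (Submodule.sub_starProjection_mem_orthogonal x))
  have hK0 : K 0 ≠ ⊥ := fun h => hinf 0 (by rw [h]; infer_instance)
  refine ⟨U, hU, Set.ext fun μ => ?_⟩
  rw [mem_pointSpectrum]
  constructor
  · rintro ⟨x, hx0, hx⟩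
    have hμ : μ ≠ 0 := by
      rintro rfl
      rw [zero_smul] at hx
      exact hx0 (hinj (hx.trans (map_zero T).symm))
    refine ⟨hμ, mem_of_isRadiusCutoff_right horth htop hinj hTP hS (fun n y hy => ?_) hμ hx0 hx,
      mem_of_isRadiusCutoff_left horth htop hinj hTP (inv_pos.2 hl₂) hS' (fun n y hy => ?_)
        hμ hx0 hx⟩
    · exact hlow (n + 1) (by omega) y hy
    · rw [← hneg] at hy
      exact hup (Int.negSucc n) (by omega) y hy
  · rintro ⟨hμ, hμS, hμS'⟩
    refine exists_eigenvector_of_isRadiusCutoff horth htop hT hTP hl₁ (inv_pos.2 hl₂) hS hS'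
      (fun n y hy => ?_) (fun n y hy => ?_) hK0 hμ hμS hμS'
    · exact hup (n + 1) (by omega) y hy
    · rw [← hneg] at hy
      exact hlow (Int.negSucc n) (by omega) y hy

end Assembly

/-- Each boundary circle is handled separately, by an `Ici` cutoff if it belongs to `R` and an `Ioi`
cutoff otherwise; the outer one uses radius `b⁻¹`. A circle inside `R` lies strictly between `l₁`
and `l₂`, which is what `Ici` needs. -/
theorem exists_radii_of_isAnnularRing {R : Set ℂ} (hR : IsAnnularRing R) {l₁ l₂ : ℝ}
    (hl₁ : 0 < l₁) (hRsub : R ⊆ {z : ℂ | l₁ < ‖z‖ ∧ ‖z‖ < l₂}) :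
    ∃ (c d c' d' : ℕ → ℝ) (S S' : Set ℝ) (m₁ m₂ : ℝ), l₁ ≤ m₁ ∧ m₁ < m₂ ∧ m₂ ≤ l₂ ∧
      IsRadiusCutoff c d l₁ m₁ S ∧ IsRadiusCutoff c' d' l₂⁻¹ m₂⁻¹ S' ∧
      {μ : ℂ | μ ≠ 0 ∧ ‖μ‖ ∈ S ∧ ‖μ‖⁻¹ ∈ S'} = R := by
  obtain ⟨a, b, ha, hab, hcases⟩ := hR
  have hb : 0 < b := ha.trans hab
  have hIoo : {z : ℂ | a < ‖z‖ ∧ ‖z‖ < b} ⊆ R := by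
    rcases hcases with rfl | rfl | rfl | rfl
    exacts [fun z h => h, fun z h => ⟨h.1.le, h.2.le⟩, fun z h => ⟨h.1.le, h.2⟩,
      fun z h => ⟨h.1, h.2.le⟩]
  -- Positive real points of `R` and a closure argument give `l₁ ≤ a` and `b ≤ l₂`, even when the
  -- boundary circles are excluded.
  have hmem : ∀ r ∈ Set.Ioo a b, r ∈ Set.Icc l₁ l₂ := fun r hr => by
    have hnorm : ‖(r : ℂ)‖ = r := by
      rw [Complex.norm_real, Real.norm_of_nonneg (ha.trans hr.1).le]
    have h := hRsub (hIoo (show (r : ℂ) ∈ _ by rwa [Set.mem_ofPred_eq, hnorm]))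
    rw [Set.mem_ofPred_eq, hnorm] at h
    exact ⟨h.1.le, h.2.le⟩
  have hcl := closure_minimal hmem isClosed_Icc
  rw [closure_Ioo hab.ne] at hcl
  have hla : l₁ ≤ a := (hcl (Set.left_mem_Icc.2 hab.le)).1
  have hbl : b ≤ l₂ := (hcl (Set.right_mem_Icc.2 hab.le)).2
  have hla' : (a : ℂ) ∈ R → l₁ < a := fun h => by
    have := (hRsub h).1
    rwa [Complex.norm_real, Real.norm_of_nonneg ha.le] at this
  have hbl' : (b : ℂ) ∈ R → b < l₂ := fun h => by
    have := (hRsub h).2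
    rwa [Complex.norm_real, Real.norm_of_nonneg hb.le] at this
  have hl₂ : 0 < l₂ := hb.trans_le hbl
  obtain ⟨m₁, ham₁, hm₁b⟩ := exists_between hab
  obtain ⟨m₂, hm, hm₂b⟩ := exists_between hm₁b
  have hm₂0 : 0 < m₂ := ha.trans (ham₁.trans hm)
  have hbm : b⁻¹ < m₂⁻¹ := inv_strictAnti₀ hm₂0 hm₂b
  have hlb : l₂⁻¹ ≤ b⁻¹ := inv_anti₀ hb hbl
  have hnorm_a : ‖(a : ℂ)‖ = a := by rw [Complex.norm_real, Real.norm_of_nonneg ha.le]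
  have hnorm_b : ‖(b : ℂ)‖ = b := by rw [Complex.norm_real, Real.norm_of_nonneg hb.le]
  obtain ⟨c, d, hoo⟩ := exists_isRadiusCutoff_Ioi hl₁ hla ham₁
  obtain ⟨c', d', hoo'⟩ := exists_isRadiusCutoff_Ioi (inv_pos.2 hl₂) hlb hbm
  have hclosed : (a : ℂ) ∈ R → ∃ c d, IsRadiusCutoff c d l₁ m₁ (Set.Ici a) := fun h =>
    exists_isRadiusCutoff_Ici hl₁ (hla' h) ham₁
  have hclosed' : (b : ℂ) ∈ R → ∃ c d, IsRadiusCutoff c d l₂⁻¹ m₂⁻¹ (Set.Ici b⁻¹) := fun h =>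
    exists_isRadiusCutoff_Ici (inv_pos.2 hl₂) (inv_strictAnti₀ hb (hbl' h)) hbm
  have hlm : l₁ ≤ m₁ := hla.trans ham₁.le
  have hml : m₂ ≤ l₂ := hm₂b.le.trans hbl
  have hne : ∀ μ : ℂ, a ≤ ‖μ‖ → μ ≠ 0 := fun μ h => norm_pos_iff.1 (ha.trans_le h)
  have hlt : ∀ μ : ℂ, μ ≠ 0 → (b⁻¹ < ‖μ‖⁻¹ ↔ ‖μ‖ < b) := fun μ h =>
    inv_lt_inv₀ hb (norm_pos_iff.2 h)
  have hle : ∀ μ : ℂ, μ ≠ 0 → (b⁻¹ ≤ ‖μ‖⁻¹ ↔ ‖μ‖ ≤ b) := fun μ h =>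
    inv_le_inv₀ hb (norm_pos_iff.2 h)
  rcases hcases with rfl | rfl | rfl | rfl
  · refine ⟨c, d, c', d', _, _, m₁, m₂, hlm, hm, hml, hoo, hoo', Set.ext fun μ => ?_⟩
    exact ⟨fun h => ⟨h.2.1, (hlt μ h.1).1 h.2.2⟩, fun h =>
      have h0 := hne μ h.1.le
      ⟨h0, h.1, (hlt μ h0).2 h.2⟩⟩
  · obtain ⟨c, d, hcc⟩ := hclosed ⟨hnorm_a.ge, hnorm_a.trans_le hab.le⟩
    obtain ⟨c', d', hcc'⟩ := hclosed' ⟨hab.le.trans_eq hnorm_b.symm, hnorm_b.le⟩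
    refine ⟨c, d, c', d', _, _, m₁, m₂, hlm, hm, hml, hcc, hcc', Set.ext fun μ => ?_⟩
    exact ⟨fun h => ⟨h.2.1, (hle μ h.1).1 h.2.2⟩, fun h =>
      have h0 := hne μ h.1
      ⟨h0, h.1, (hle μ h0).2 h.2⟩⟩
  · obtain ⟨c, d, hcc⟩ := hclosed ⟨hnorm_a.ge, hnorm_a.trans_lt hab⟩
    refine ⟨c, d, c', d', _, _, m₁, m₂, hlm, hm, hml, hcc, hoo', Set.ext fun μ => ?_⟩
    exact ⟨fun h => ⟨h.2.1, (hlt μ h.1).1 h.2.2⟩, fun h =>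
      have h0 := hne μ h.1
      ⟨h0, h.1, (hlt μ h0).2 h.2⟩⟩
  · obtain ⟨c', d', hcc'⟩ := hclosed' ⟨hab.trans_eq hnorm_b.symm, hnorm_b.le⟩
    refine ⟨c, d, c', d', _, _, m₁, m₂, hlm, hm, hml, hoo, hcc', Set.ext fun μ => ?_⟩
    exact ⟨fun h => ⟨h.2.1, (hle μ h.1).1 h.2.2⟩, fun h =>
      have h0 := hne μ h.1.le
      ⟨h0, h.1, (hle μ h0).2 h.2⟩⟩

theorem mainTheorem3 {H : Type*} [NormedAddCommGroup H] [InnerProductSpace ℂ H] [CompleteSpace H]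
    [TopologicalSpace.SeparableSpace H] (A : H →L[ℂ] H) (hA : IsSelfAdjoint A)
    (l₁ l₂ : ℝ) (hl₁ : 0 < l₁) (hl : l₁ < l₂)
    (hspec : spectrum ℂ A = (fun t : ℝ => (t : ℂ)) '' Set.Icc l₁ l₂)
    (hpoint : pointSpectrum A = ∅)
    (R : Set ℂ) (hR : IsAnnularRing R) (hRsub : R ⊆ {z : ℂ | l₁ < ‖z‖ ∧ ‖z‖ < l₂}) :
    ∃ U : H →L[ℂ] H, IsUnitarySpread U ∧ pointSpectrum (U ∘L A) = R := by
  have hspecR : spectrum ℝ A = Set.Icc l₁ l₂ := by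
    rw [← spectrum.preimage_algebraMap ℂ, hspec]
    exact Set.preimage_image_eq _ Complex.ofReal_injective
  obtain ⟨c, d, c', d', S, S', m₁, m₂, hm₁, hm, hm₂, hS, hS', rfl⟩ :=
    exists_radii_of_isAnnularRing hR hl₁ hRsub
  exact exists_isUnitarySpread_pointSpectrum hA hpoint hl₁ hm₁ hm hm₂ hspecR hS hS'
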